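/- **Theorem 3.7.** Let $\mathcal F^2$ be the Fock space, i.e. the Hilbert space of all entire functions $f$ with $\frac1\pi\int_{\mathbb C}|f(z)|^2e^{-|z|^2}\,dV(z)<\infty$ ($dV$ is Lebesgue measure on $\mathbb C$), with inner product $\langle f,g\rangle=\frac1\pi\int_{\mathbb C}f(z)\overline{g(z)}e^{-|z|^2}\,dV(z)$. For entire functions $\psi,\varphi$, let $W_{\psi,\varphi,\max}$ be the maximal weighted composition operator on $\mathcal F^2$: its domain is $\{f\in\mathcal F^2:\psi\cdot (f\circ\varphi)\in\mathcal F^2\}$, and $W_{\psi,\varphi,\max}f=\psi\cdot (f\circ\varphi)$ for $f$ in this domain. Let $A,B,C,D\in\mathbb C$ with $C\neq0$, and put $$\psi(z)=Ce^{Dz},\qquad \varphi(z)=Az+B,\qquad \widehat\psi(z)=\overline C\,e^{\overline Bz},\qquad \widehat\varphi(z)=\overline Az+\overline D .$$ Then $W_{\psi,\varphi,\max}$ is densely defined, and its Hilbert space adjoint is $$W_{\psi,\varphi,\max}^*=W_{\widehat\psi,\widehat\varphi,\max}$$ (equality of unbounded operators, including equality of their domains). -/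

import Mathlib

/-- The Gaussian measure `π⁻¹ exp (-|z|²) dV(z)` on the complex plane. -/
noncomputable def fockMeasure : MeasureTheory.Measure ℂ :=
  MeasureTheory.volume.withDensity
    (fun z : ℂ => ENNReal.ofReal (Real.pi⁻¹ * Real.exp (-‖z‖ ^ 2)))

/-- The entire functions that are square integrable with respect to the Gaussian measure,
as a linear subspace of the space of all functions `ℂ → ℂ`. -/
def fockSubmodule : Submodule ℂ (ℂ → ℂ) where
  carrier := {f | Differentiable ℂ f ∧ MeasureTheory.MemLp f 2 fockMeasure}
  add_mem' hf hg := ⟨hf.1.add hg.1, hf.2.add hg.2⟩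
  zero_mem' := ⟨differentiable_const 0, MeasureTheory.MemLp.zero⟩
  smul_mem' c _ hf := ⟨hf.1.const_smul c, hf.2.const_smul c⟩

/-- The Fock space: its elements are the functions in `fockSubmodule`. It is a type of its own
because the subspace topology of pointwise convergence on `fockSubmodule` is not the one wanted. -/
def FockSpace : Type := fockSubmodule

namespace FockSpace

noncomputable instance instAddCommGroup : AddCommGroup FockSpace :=
  inferInstanceAs (AddCommGroup fockSubmodule)

noncomputable instance instModule : Module ℂ FockSpace :=
  inferInstanceAs (Module ℂ fockSubmodule)

instance instFunLike : FunLike FockSpace ℂ ℂ where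
  coe f := f.1
  coe_injective := Subtype.val_injective

theorem mem (f : FockSpace) : (f : ℂ → ℂ) ∈ fockSubmodule := f.2

@[ext]
theorem ext {f g : FockSpace} (h : ∀ z, f z = g z) : f = g := DFunLike.ext f g h

/-- The element of the Fock space given by a function. -/
def mk (f : ℂ → ℂ) (hf : f ∈ fockSubmodule) : FockSpace := Subtype.mk f hf

@[simp]
theorem mk_apply (f : ℂ → ℂ) (hf : f ∈ fockSubmodule) (z : ℂ) : mk f hf z = f z := rfl

@[simp]
theorem add_apply (f g : FockSpace) (z : ℂ) : (f + g) z = f z + g z := rfl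

@[simp]
theorem sub_apply (f g : FockSpace) (z : ℂ) : (f - g) z = f z - g z := rfl

@[simp]
theorem zero_apply (z : ℂ) : (0 : FockSpace) z = 0 := rfl

@[simp]
theorem smul_apply (c : ℂ) (f : FockSpace) (z : ℂ) : (c • f) z = c * f z := rfl

theorem differentiable (f : FockSpace) : Differentiable ℂ f := f.mem.1

theorem memLp (f : FockSpace) : MeasureTheory.MemLp f 2 fockMeasure := f.mem.2

theorem integrable_conj_mul (f g : FockSpace) :
    MeasureTheory.Integrable (fun z => (starRingEnd ℂ) (f z) * g z) fockMeasure :=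
  MeasureTheory.MemLp.integrable_mul (p := 2) (q := 2) f.memLp.star g.memLp

theorem ae_volume_of_ae_fockMeasure {p : ℂ → Prop} (h : ∀ᵐ z ∂fockMeasure, p z) :
    ∀ᵐ z : ℂ, p z := by
  rw [fockMeasure, MeasureTheory.ae_withDensity_iff (by fun_prop)] at h
  filter_upwards [h] with z hz
  apply hz
  rw [Ne, ENNReal.ofReal_eq_zero, not_le]
  positivity

theorem eq_zero_of_ae (f : FockSpace) (h : (f : ℂ → ℂ) =ᵐ[fockMeasure] 0) : f = 0 := by
  have h1 : (f : ℂ → ℂ) =ᵐ[MeasureTheory.volume] 0 := ae_volume_of_ae_fockMeasure h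
  have h2 : (f : ℂ → ℂ) = 0 :=
    MeasureTheory.Measure.eq_of_ae_eq h1 f.differentiable.continuous continuous_const
  exact ext fun z => congrFun h2 z

/-- The inner product of the Fock space. As everywhere in Mathlib it is linear in the second
argument: `inner ℂ f g` is the integral of `conj f * g` against the Gaussian measure. -/
noncomputable instance instInner : Inner ℂ FockSpace where
  inner f g := ∫ z, (starRingEnd ℂ) (f z) * g z ∂fockMeasure

theorem inner_def (f g : FockSpace) :
    inner ℂ f g = ∫ z, (starRingEnd ℂ) (f z) * g z ∂fockMeasure := rfl

theorem inner_eq_inner_toLp (f g : FockSpace) :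
    inner ℂ f g = inner ℂ (f.memLp.toLp f) (g.memLp.toLp g) := by
  rw [inner_def, MeasureTheory.L2.inner_def]
  refine MeasureTheory.integral_congr_ae ?_
  filter_upwards [f.memLp.coeFn_toLp, g.memLp.coeFn_toLp] with z hf hg
  rw [hf, hg, RCLike.inner_apply, mul_comm]

/-- The axioms of an inner product, proved by comparison with the `L²` space. -/
noncomputable abbrev core : InnerProductSpace.Core ℂ FockSpace where
  toInner := instInner
  conj_inner_symm f g := by
    simp only [inner_eq_inner_toLp]
    exact inner_conj_symm _ _
  re_inner_nonneg f := by
    simp only [inner_eq_inner_toLp]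
    exact inner_self_nonneg
  add_left f g h := by
    simp only [inner_eq_inner_toLp]
    rw [← inner_add_left]
    rfl
  smul_left f g c := by
    simp only [inner_eq_inner_toLp]
    rw [← inner_smul_left]
    rfl
  definite f hf := by
    rw [inner_eq_inner_toLp, inner_self_eq_zero] at hf
    refine f.eq_zero_of_ae ?_
    exact (f.memLp.toLp_eq_toLp_iff MeasureTheory.MemLp.zero).mp
      (hf.trans (MeasureTheory.MemLp.toLp_zero _).symm)

noncomputable instance instNormedAddCommGroup : NormedAddCommGroup FockSpace :=
  @InnerProductSpace.Core.toNormedAddCommGroup ℂ FockSpace _ _ _ core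

noncomputable instance instInnerProductSpace : InnerProductSpace ℂ FockSpace :=
  InnerProductSpace.ofCore core.toCore

theorem norm_eq_norm_toLp (f : FockSpace) : ‖f‖ = ‖f.memLp.toLp f‖ := by
  rw [@norm_eq_sqrt_re_inner ℂ, @norm_eq_sqrt_re_inner ℂ]
  exact congrArg _ (congrArg _ (inner_eq_inner_toLp f f))

/-- The mean value inequality over the unit disc. -/
theorem mean_value_le {h : ℂ → ℂ} (hh : Differentiable ℂ h) (z : ℂ) :
    ENNReal.ofReal Real.pi * ‖h z‖ₑ ≤ ∫⁻ w in Metric.ball z 1, ‖h w‖ₑ := by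
  have hc : Continuous h := hh.continuous
  have key : ∀ r : ℝ, ENNReal.ofReal (2 * Real.pi) * ‖h z‖ₑ ≤
      ∫⁻ t in Set.Ioo (-Real.pi) Real.pi, ‖h (circleMap z r t)‖ₑ := by
    intro r
    have h1 : Real.circleAverage h z r = h z := hh.diffContOnCl.circleAverage
    have h2 : (∫ t in Set.Ioo (-Real.pi) Real.pi, h (circleMap z r t)) = (2 * Real.pi) • h z := by
      rw [← h1, Real.circleAverage_def, smul_smul, mul_inv_cancel₀ Real.two_pi_pos.ne', one_smul]
      have h3 := ((periodic_circleMap z r).comp h).intervalIntegral_add_eq (-Real.pi) 0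
      rw [zero_add] at h3
      have h4 : -Real.pi + 2 * Real.pi = Real.pi := by ring
      rw [h4] at h3
      rw [← MeasureTheory.integral_Ioc_eq_integral_Ioo,
        ← intervalIntegral.integral_of_le (by linarith [Real.pi_pos])]
      exact h3
    have h5 := MeasureTheory.enorm_integral_le_lintegral_enorm
      (μ := MeasureTheory.volume.restrict (Set.Ioo (-Real.pi) Real.pi))
      (fun t => h (circleMap z r t))
    rw [h2, enorm_smul, Real.enorm_eq_ofReal Real.two_pi_pos.le] at h5
    exact h5
  have hr : ∫⁻ r in Set.Ioo (0 : ℝ) 1, ENNReal.ofReal r = ENNReal.ofReal (1 / 2) := by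
    rw [← MeasureTheory.ofReal_integral_eq_lintegral_ofReal]
    · congr 1
      rw [← MeasureTheory.integral_Ioc_eq_integral_Ioo,
        ← intervalIntegral.integral_of_le zero_le_one, integral_id]
      norm_num
    · exact (continuous_id.integrableOn_Icc (a := (0 : ℝ)) (b := 1)).mono_set
        Set.Ioo_subset_Icc_self
    · filter_upwards [MeasureTheory.ae_restrict_mem measurableSet_Ioo] with r hr using hr.1.le
  let F : ℂ → ENNReal := (Metric.ball (0 : ℂ) 1).indicator fun w => ‖h (z + w)‖ₑ
  calc ENNReal.ofReal Real.pi * ‖h z‖ₑ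
      = ∫⁻ r in Set.Ioo (0 : ℝ) 1,
          ENNReal.ofReal r * (ENNReal.ofReal (2 * Real.pi) * ‖h z‖ₑ) := by
        rw [MeasureTheory.lintegral_mul_const _ (by fun_prop), hr, ← mul_assoc,
          ← ENNReal.ofReal_mul (by norm_num)]
        congr 2
        ring
    _ ≤ ∫⁻ r in Set.Ioo (0 : ℝ) 1, ∫⁻ t in Set.Ioo (-Real.pi) Real.pi,
          ENNReal.ofReal r * ‖h (circleMap z r t)‖ₑ := by
        refine MeasureTheory.lintegral_mono fun r => ?_
        have hm : Measurable fun t => ‖h (circleMap z r t)‖ₑ :=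
          (hc.comp (continuous_circleMap z r)).enorm.measurable
        simp only
        rw [MeasureTheory.lintegral_const_mul _ hm]
        gcongr
        exact key r
    _ = ∫⁻ p in Set.Ioo (0 : ℝ) 1 ×ˢ Set.Ioo (-Real.pi) Real.pi,
          ENNReal.ofReal p.1 * ‖h (circleMap z p.1 p.2)‖ₑ := by
        rw [MeasureTheory.Measure.volume_eq_prod, ← MeasureTheory.Measure.prod_restrict,
          MeasureTheory.lintegral_prod]
        have hc2 : Continuous fun p : ℝ × ℝ => h (circleMap z p.1 p.2) := by
          unfold circleMap
          fun_prop
        exact ((by fun_prop : Measurable fun p : ℝ × ℝ => ENNReal.ofReal p.1).mul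
          hc2.enorm.measurable).aemeasurable
    _ = ∫⁻ p in Set.Ioo (0 : ℝ) 1 ×ˢ Set.Ioo (-Real.pi) Real.pi,
          ENNReal.ofReal p.1 • F (Complex.polarCoord.symm p) := by
        refine MeasureTheory.setLIntegral_congr_fun
          (measurableSet_Ioo.prod measurableSet_Ioo) fun p hp => ?_
        have h1 : Complex.polarCoord.symm p ∈ Metric.ball (0 : ℂ) 1 := by
          rw [mem_ball_zero_iff, Complex.norm_polarCoord_symm, abs_of_pos hp.1.1]
          exact hp.1.2
        simp only [F]
        rw [Set.indicator_of_mem h1, smul_eq_mul, Complex.polarCoord_symm_apply, circleMap,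
          Complex.exp_mul_I, Complex.ofReal_cos, Complex.ofReal_sin]
    _ ≤ ∫⁻ p in polarCoord.target, ENNReal.ofReal p.1 • F (Complex.polarCoord.symm p) :=
        MeasureTheory.lintegral_mono_set (Set.prod_mono Set.Ioo_subset_Ioi_self subset_rfl)
    _ = ∫⁻ w, F w := Complex.lintegral_comp_polarCoord_symm F
    _ = ∫⁻ w, (Metric.ball z 1).indicator (fun w => ‖h w‖ₑ) (z + w) := by
        refine MeasureTheory.lintegral_congr fun w => ?_
        simp only [F, Set.indicator, Metric.mem_ball, dist_self_add_left, dist_zero_right]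
    _ = ∫⁻ w in Metric.ball z 1, ‖h w‖ₑ := by
        rw [MeasureTheory.lintegral_add_left_eq_self
          (f := (Metric.ball z 1).indicator fun w => ‖h w‖ₑ),
          MeasureTheory.lintegral_indicator Metric.isOpen_ball.measurableSet]

theorem enorm_sq_eq (f : FockSpace) : ‖f‖ₑ ^ 2 = ∫⁻ w, ‖f w‖ₑ ^ 2 ∂fockMeasure := by
  have h1 : ‖f‖ₑ = MeasureTheory.eLpNorm f 2 fockMeasure := by
    rw [← MeasureTheory.Lp.enorm_toLp (hf := f.memLp), ← ofReal_norm, ← ofReal_norm,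
      norm_eq_norm_toLp]
  rw [h1, MeasureTheory.eLpNorm_eq_lintegral_rpow_enorm_toReal (by norm_num) (by norm_num)]
  rw [← ENNReal.rpow_natCast, ← ENNReal.rpow_mul]
  simp

/-- Point evaluations are bounded, locally uniformly in the point. -/
theorem norm_apply_le (f : FockSpace) {R : ℝ} {z : ℂ} (hz : ‖z‖ ≤ R) :
    ‖f z‖ ≤ Real.exp ((R + 1) ^ 2 / 2) * ‖f‖ := by
  have hR : 0 ≤ R := (norm_nonneg z).trans hz
  have h1 := mean_value_le (f.differentiable.pow 2) z
  have h2 : ∫⁻ w in Metric.ball z 1, ‖((f : ℂ → ℂ) ^ 2) w‖ₑ ≤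
      ENNReal.ofReal (Real.pi * Real.exp ((R + 1) ^ 2)) * ‖f‖ₑ ^ 2 := by
    have hm : Measurable fun w => ‖f w‖ₑ ^ 2 :=
      f.differentiable.continuous.enorm.measurable.pow_const 2
    rw [enorm_sq_eq, fockMeasure, MeasureTheory.lintegral_withDensity_eq_lintegral_mul _
      (by fun_prop) hm, ← MeasureTheory.lintegral_const_mul _
        ((by fun_prop : Measurable fun z : ℂ =>
          ENNReal.ofReal (Real.pi⁻¹ * Real.exp (-‖z‖ ^ 2))).mul hm)]
    refine (MeasureTheory.setLIntegral_mono' Metric.isOpen_ball.measurableSet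
      fun w hw => ?_).trans (MeasureTheory.setLIntegral_le_lintegral (Metric.ball z 1) _)
    have hw' : ‖w‖ ≤ R + 1 := by
      have := norm_le_norm_add_norm_sub' w z
      rw [Metric.mem_ball, dist_eq_norm] at hw
      linarith
    simp only [Pi.mul_apply, Pi.pow_apply, enorm_pow]
    rw [← mul_assoc, ← ENNReal.ofReal_mul (by positivity)]
    refine le_mul_of_one_le_left' ?_
    rw [ENNReal.one_le_ofReal]
    have : Real.pi * Real.exp ((R + 1) ^ 2) * (Real.pi⁻¹ * Real.exp (-‖w‖ ^ 2)) =
        Real.exp ((R + 1) ^ 2 - ‖w‖ ^ 2) := by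
      rw [sub_eq_add_neg, Real.exp_add]
      field_simp
    rw [this, Real.one_le_exp_iff, sub_nonneg]
    gcongr
  have h3 := h1.trans h2
  simp only [Pi.pow_apply, enorm_pow] at h3
  rw [← ofReal_norm, ← ofReal_norm, ← ENNReal.ofReal_pow (norm_nonneg _),
    ← ENNReal.ofReal_pow (norm_nonneg _), ← ENNReal.ofReal_mul (by positivity),
    ← ENNReal.ofReal_mul (by positivity), ENNReal.ofReal_le_ofReal_iff (by positivity),
    mul_assoc] at h3
  have h4 := le_of_mul_le_mul_left h3 Real.pi_pos
  refine abs_le_of_sq_le_sq' ?_ (by positivity) |>.2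
  rw [mul_pow, ← Real.exp_nat_mul]
  convert h4 using 3
  push_cast
  ring

/-- The Fock space is a Hilbert space. -/
instance instCompleteSpace : CompleteSpace FockSpace := by
  refine Metric.complete_of_cauchySeq_tendsto fun u hu => ?_
  -- the limit in the `L²` space
  have hL : CauchySeq fun n => (u n).memLp.toLp (u n) := by
    rw [Metric.cauchySeq_iff] at hu ⊢
    intro ε hε
    obtain ⟨N, hN⟩ := hu ε hε
    refine ⟨N, fun m hm n hn => ?_⟩
    have := hN m hm n hn
    rw [dist_eq_norm, norm_eq_norm_toLp] at this
    rw [dist_eq_norm]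
    exact this
  obtain ⟨g, hg⟩ := cauchySeq_tendsto_of_complete hL
  -- the pointwise limit
  have hP : ∀ R : ℝ, UniformCauchySeqOn (fun n => (u n : ℂ → ℂ)) Filter.atTop
      (Metric.closedBall 0 R) := by
    intro R
    rw [Metric.uniformCauchySeqOn_iff]
    intro ε hε
    obtain ⟨N, hN⟩ := Metric.cauchySeq_iff.mp hu (ε / Real.exp ((R + 1) ^ 2 / 2)) (by positivity)
    refine ⟨N, fun m hm n hn z hz => ?_⟩
    have h1 := hN m hm n hn
    rw [lt_div_iff₀ (by positivity), mul_comm, dist_eq_norm] at h1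
    have h2 := norm_apply_le (u m - u n) (mem_closedBall_zero_iff.mp hz)
    rw [dist_eq_norm]
    exact h2.trans_lt h1
  have hlim : ∀ z : ℂ, ∃ l, Filter.Tendsto (fun n => u n z) Filter.atTop (nhds l) := fun z =>
    cauchySeq_tendsto_of_complete ((hP ‖z‖).cauchySeq (mem_closedBall_zero_iff.mpr le_rfl))
  choose f hf using hlim
  have hdiff : Differentiable ℂ f := by
    rw [← differentiableOn_univ]
    have hloc : TendstoLocallyUniformlyOn (fun n => (u n : ℂ → ℂ)) f Filter.atTop Set.univ := by
      rw [tendstoLocallyUniformlyOn_iff_forall_isCompact isOpen_univ]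
      intro K _ hK
      obtain ⟨R, hR⟩ := hK.isBounded.subset_closedBall 0
      exact ((hP R).tendstoUniformlyOn_of_tendsto fun z _ => hf z).mono hR
    exact hloc.differentiableOn
      (Filter.Eventually.of_forall fun n => (u n).differentiable.differentiableOn) isOpen_univ
  have hfg : (g : ℂ → ℂ) =ᵐ[fockMeasure] f := by
    have hm := MeasureTheory.tendstoInMeasure_of_tendsto_Lp hg
    obtain ⟨ns, hns, hae⟩ := hm.exists_seq_tendsto_ae
    have hall : ∀ᵐ z ∂fockMeasure, ∀ n, (u n).memLp.toLp (u n) z = u n z :=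
      MeasureTheory.ae_all_iff.mpr fun n => (u n).memLp.coeFn_toLp
    filter_upwards [hae, hall] with z hz1 hz2
    simp only [hz2] at hz1
    exact tendsto_nhds_unique hz1 ((hf z).comp hns.tendsto_atTop)
  have hmem : f ∈ fockSubmodule :=
    ⟨hdiff, (MeasureTheory.memLp_congr_ae hfg).mp (MeasureTheory.Lp.memLp g)⟩
  let F : FockSpace := mk f hmem
  have hF : F.memLp.toLp F = g := by
    refine MeasureTheory.Lp.ext ?_
    exact F.memLp.coeFn_toLp.trans hfg.symm
  refine ⟨F, ?_⟩
  rw [tendsto_iff_norm_sub_tendsto_zero] at hg ⊢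
  refine hg.congr fun n => ?_
  rw [norm_eq_norm_toLp, ← hF]
  rfl

end FockSpace

/-- The maximal weighted composition operator on the Fock space with the symbols `ψ` and `φ`: its
domain consists of all `f` in the Fock space for which `z ↦ ψ z * f (φ z)` lies again in the Fock
space, and it sends such an `f` to that function. -/
noncomputable def weightedCompositionMax (ψ φ : ℂ → ℂ) : FockSpace →ₗ.[ℂ] FockSpace where
  domain :=
    { carrier := {f | (fun z => ψ z * f (φ z)) ∈ fockSubmodule}
      add_mem' := fun {f g} hf hg => by
        have h : (fun z => ψ z * (f + g) (φ z)) =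
            (fun z => ψ z * f (φ z)) + fun z => ψ z * g (φ z) := funext fun z => mul_add _ _ _
        change _ ∈ fockSubmodule
        rw [h]
        exact fockSubmodule.add_mem hf hg
      zero_mem' := by
        have h : (fun z => ψ z * (0 : FockSpace) (φ z)) = 0 := funext fun z => mul_zero _
        change _ ∈ fockSubmodule
        rw [h]
        exact fockSubmodule.zero_mem
      smul_mem' := fun c f hf => by
        have h : (fun z => ψ z * (c • f) (φ z)) = c • fun z => ψ z * f (φ z) :=
          funext fun z => mul_left_comm _ _ _
        change _ ∈ fockSubmodule
        rw [h]
        exact fockSubmodule.smul_mem c hf }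
  toFun :=
    { toFun := fun f => FockSpace.mk (fun z => ψ z * (f : FockSpace) (φ z)) f.2
      map_add' := fun f g => FockSpace.ext fun z => mul_add _ _ _
      map_smul' := fun c f => FockSpace.ext fun z => mul_left_comm _ _ _ }

theorem mem_weightedCompositionMax_domain {ψ φ : ℂ → ℂ} {f : FockSpace} :
    f ∈ (weightedCompositionMax ψ φ).domain ↔ (fun z => ψ z * f (φ z)) ∈ fockSubmodule :=
  Iff.rfl

theorem weightedCompositionMax_apply {ψ φ : ℂ → ℂ} (f : (weightedCompositionMax ψ φ).domain)
    (z : ℂ) : weightedCompositionMax ψ φ f z = ψ z * (f : FockSpace) (φ z) :=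
  rfl

/-! Write `W` for the operator with symbols ψ, φ and `V` for the one with the hatted symbols.
Everything is tested on the reproducing kernels `k_w(z) = exp(conj w * z)`. `W` sends each kernel to
a multiple of a kernel, so its domain is dense, and by `inner_kernel`, `⟨W k_w, g⟩ = conj C exp(conj
B w) g(conj A w + conj D)`, the formal value of `V g` at `w`. For `g` in the domain of the adjoint
this says that the adjoint is a restriction of `V`.

The reverse inclusion requires `⟨W f, g⟩ = ⟨f, V g⟩` for all `f`, `g` in the two maximal domains,
hence that the kernels span a core of `W`. If `(f, W f)` is orthogonal to every `(k_w, W k_w)`, then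
pointwise `f + V W f = 0`, that is, `f(z) = -k exp(conj m z) f(α z + m)` with `k > 0`, `α = |A|² ≥
0` and `m = A conj D + B`. `eq_zero_of_affine_eq` shows that only `f = 0` solves this. If `z ↦ α z +
m` has a fixed point, the lowest-order Taylor coefficients there have incompatible signs
(`eq_zero_of_dilation_eq`). Otherwise the map is a nontrivial translation, and Fock growth with
Liouville's theorem excludes `f ≠ 0` (`eq_zero_of_translation_eq`). -/

/-! ### Gaussian integrals of entire functions -/

open MeasureTheory in
theorem integral_fockMeasure (f : ℂ → ℂ) :
    ∫ z, f z ∂fockMeasure = ∫ z : ℂ, (Real.pi⁻¹ * Real.exp (-‖z‖ ^ 2)) • f z := by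
  rw [fockMeasure, integral_withDensity_eq_integral_toReal_smul (by fun_prop) (by simp)]
  refine integral_congr_ae (.of_forall fun z => ?_)
  simp only
  rw [ENNReal.toReal_ofReal (by positivity)]

open MeasureTheory in
theorem integrable_fockMeasure_iff {E : Type*} [NormedAddCommGroup E] [NormedSpace ℝ E]
    (f : ℂ → E) : Integrable f fockMeasure ↔
      Integrable fun z : ℂ => (Real.pi⁻¹ * Real.exp (-‖z‖ ^ 2)) • f z := by
  rw [fockMeasure, integrable_withDensity_iff_integrable_smul' (by fun_prop) (by simp)]
  refine integrable_congr (.of_forall fun z => ?_)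
  simp only
  rw [ENNReal.toReal_ofReal (by positivity)]

theorem integral_exp_neg_norm_sq : ∫ z : ℂ, Real.exp (-‖z‖ ^ 2) = Real.pi := by
  have h := GaussianFourier.integral_rexp_neg_mul_sq_norm (V := ℂ) one_pos
  simpa using h

theorem integrable_exp_neg_norm_sq :
    MeasureTheory.Integrable fun z : ℂ => Real.exp (-‖z‖ ^ 2) :=
  MeasureTheory.Integrable.of_integral_ne_zero
    (by rw [integral_exp_neg_norm_sq]; exact Real.pi_ne_zero)

open MeasureTheory in
/-- The Gaussian mean value property of entire functions. -/
theorem integral_fockMeasure_eq_apply_zero {h : ℂ → ℂ} (hd : Differentiable ℂ h)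
    (hi : Integrable h fockMeasure) : ∫ z, h z ∂fockMeasure = h 0 := by
  rw [integral_fockMeasure]
  rw [integrable_fockMeasure_iff] at hi
  set H : ℂ → ℂ := fun z => (Real.pi⁻¹ * Real.exp (-‖z‖ ^ 2)) • h z with hH
  have hHc : Continuous H := by
    have := hd.continuous
    fun_prop
  have hmp (θ : ℝ) : MeasurePreserving (fun z : ℂ => (Circle.exp θ : ℂ) * z) :=
    (rotation (Circle.exp θ)).measurePreserving
  have hemb (θ : ℝ) : MeasurableEmbedding (fun z : ℂ => (Circle.exp θ : ℂ) * z) :=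
    (rotation (Circle.exp θ)).toHomeomorph.measurableEmbedding
  have hrot (θ : ℝ) : ∫ z, H ((Circle.exp θ : ℂ) * z) = ∫ z, H z :=
    (hmp θ).integral_comp (hemb θ) H
  have hc2 : Continuous fun p : ℝ × ℂ => H ((Circle.exp p.1 : ℂ) * p.2) := by fun_prop
  have hprod : Integrable (Function.uncurry fun (θ : ℝ) (z : ℂ) => H ((Circle.exp θ : ℂ) * z))
      ((volume.restrict (Set.uIoc 0 (2 * Real.pi))).prod volume) := by
    refine (integrable_prod_iff hc2.aestronglyMeasurable).mpr
      ⟨.of_forall fun θ => ((hmp θ).integrable_comp_emb (hemb θ)).mpr hi, ?_⟩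
    have hconst (θ : ℝ) : ∫ z, ‖H ((Circle.exp θ : ℂ) * z)‖ = ∫ z, ‖H z‖ :=
      (hmp θ).integral_comp (hemb θ) fun z => ‖H z‖
    simp only [hconst]
    exact intervalIntegrable_iff.mp intervalIntegrable_const
  -- The Gaussian weight is constant on circles, so averaging over rotations only affects `h`; the
  -- mean over the unit circle of the entire function `w ↦ h (w * z)` is `h 0`.
  have hcirc (z : ℂ) : ∫ θ in (0 : ℝ)..(2 * Real.pi), H ((Circle.exp θ : ℂ) * z) =
      (2 * Real.pi) • ((Real.pi⁻¹ * Real.exp (-‖z‖ ^ 2)) • h 0) := by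
    have h1 : Real.circleAverage (fun w => h (w * z)) 0 1 = h (0 * z) :=
      (hd.comp (differentiable_id.mul_const z)).diffContOnCl.circleAverage
    rw [Real.circleAverage_def, zero_mul] at h1
    have h2 (θ : ℝ) : H ((Circle.exp θ : ℂ) * z) =
        (Real.pi⁻¹ * Real.exp (-‖z‖ ^ 2)) • h (circleMap 0 1 θ * z) := by
      simp [hH, circleMap, Circle.coe_exp]
    simp only [h2]
    rw [intervalIntegral.integral_smul, smul_comm (2 * Real.pi), ← h1, smul_smul (2 * Real.pi),
      mul_inv_cancel₀ Real.two_pi_pos.ne', one_smul]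
  have hswap := intervalIntegral_integral_swap hprod
  simp only [hrot, hcirc] at hswap
  rw [intervalIntegral.integral_const, integral_smul, sub_zero] at hswap
  rw [smul_right_injective ℂ Real.two_pi_pos.ne' hswap, integral_smul_const,
    integral_const_mul, integral_exp_neg_norm_sq, inv_mul_cancel₀ Real.pi_ne_zero, one_smul]

/-! ### Reproducing kernels -/

namespace FockSpace

theorem exp_conj_mul_mem (w : ℂ) :
    (fun z => Complex.exp ((starRingEnd ℂ) w * z)) ∈ fockSubmodule := by
  refine ⟨by fun_prop, ?_⟩
  rw [MeasureTheory.memLp_two_iff_integrable_sq_norm (by fun_prop), integrable_fockMeasure_iff]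
  -- Completing the square: `|exp(conj w z)|² exp(-|z|²) = exp(|w|²) exp(-|z - w|²)`.
  have h1 := ((integrable_exp_neg_norm_sq.comp_sub_right w).const_mul
    (Real.pi⁻¹ * Real.exp (‖w‖ ^ 2)))
  refine h1.congr (.of_forall fun z => ?_)
  simp only [Complex.norm_exp, smul_eq_mul]
  rw [mul_assoc, mul_assoc, ← Real.exp_add, ← Real.exp_nat_mul, ← Real.exp_add]
  congr 2
  simp only [← Complex.normSq_eq_norm_sq, Complex.normSq_apply, Complex.sub_re, Complex.sub_im,
    Complex.mul_re, Complex.conj_re, Complex.conj_im]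
  push_cast
  ring

/-- The reproducing kernel of the Fock space. -/
noncomputable def kernel (w : ℂ) : FockSpace :=
  mk (fun z => Complex.exp ((starRingEnd ℂ) w * z)) (exp_conj_mul_mem w)

@[simp]
theorem kernel_apply (w z : ℂ) : kernel w z = Complex.exp ((starRingEnd ℂ) w * z) := rfl

/-- The reproducing property. -/
theorem inner_kernel (w : ℂ) (f : FockSpace) : inner ℂ (kernel w) f = f w := by
  -- Translating the integration variable by `w` turns the integrand of `⟨k_w, f⟩` into the centred
  -- Gaussian times the entire function `h`, whose value at `0` is `f w`.
  let h : ℂ → ℂ := fun u => Complex.exp (-((starRingEnd ℂ) w * u)) * f (u + w)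
  have hd : Differentiable ℂ h := by
    have := f.differentiable
    fun_prop
  have hpt (u : ℂ) : (Real.pi⁻¹ * Real.exp (-‖u‖ ^ 2)) • h u =
      (Real.pi⁻¹ * Real.exp (-‖u + w‖ ^ 2)) •
        ((starRingEnd ℂ) (kernel w (u + w)) * f (u + w)) := by
    simp only [h, kernel_apply, Complex.real_smul, ← Complex.exp_conj, Complex.ofReal_mul,
      Complex.ofReal_exp, Complex.ofReal_neg, Complex.ofReal_pow, ← Complex.mul_conj', map_mul,
      map_add, Complex.conj_conj]
    rw [mul_assoc, mul_assoc, ← mul_assoc (Complex.exp _), ← mul_assoc (Complex.exp _),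
      ← Complex.exp_add, ← Complex.exp_add]
    congr 3
    ring
  have hi := (integrable_fockMeasure_iff _).mp (integrable_conj_mul (kernel w) f)
  have hi' : MeasureTheory.Integrable h fockMeasure := by
    rw [integrable_fockMeasure_iff]
    simp only [hpt]
    exact hi.comp_add_right w
  have h1 := integral_fockMeasure_eq_apply_zero hd hi'
  rw [integral_fockMeasure] at h1
  simp only [hpt] at h1
  rw [MeasureTheory.integral_add_right_eq_self (fun u : ℂ => (Real.pi⁻¹ * Real.exp (-‖u‖ ^ 2)) •
        ((starRingEnd ℂ) (kernel w u) * f u)), ← integral_fockMeasure, ← inner_def] at h1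
  rw [h1]
  simp [h]

theorem inner_kernel_right (f : FockSpace) (w : ℂ) :
    inner ℂ f (kernel w) = (starRingEnd ℂ) (f w) := by
  rw [← inner_conj_symm, inner_kernel]

theorem norm_kernel (w : ℂ) : ‖kernel w‖ = Real.exp (‖w‖ ^ 2 / 2) := by
  have h : ((‖kernel w‖ ^ 2 : ℝ) : ℂ) = (Real.exp (‖w‖ ^ 2 / 2) ^ 2 : ℝ) := by
    push_cast
    have := inner_self_eq_norm_sq_to_K (𝕜 := ℂ) (kernel w)
    rw [inner_kernel, kernel_apply, Complex.conj_mul'] at this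
    rw [← Complex.exp_nat_mul]
    refine this.symm.trans ?_
    congr 1
    push_cast
    ring
  exact (pow_left_inj₀ (norm_nonneg _) (Real.exp_nonneg _) two_ne_zero).mp
    (Complex.ofReal_injective h)

/-- The sharp pointwise bound. -/
theorem norm_apply_le_exp (f : FockSpace) (z : ℂ) : ‖f z‖ ≤ Real.exp (‖z‖ ^ 2 / 2) * ‖f‖ := by
  rw [← inner_kernel, ← norm_kernel]
  exact norm_inner_le_norm _ _

theorem span_kernel_orthogonal : (Submodule.span ℂ (Set.range kernel))ᗮ = ⊥ := by
  rw [Submodule.eq_bot_iff]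
  intro f hf
  ext z
  rw [← inner_kernel]
  exact hf _ (Submodule.subset_span ⟨z, rfl⟩)

theorem dense_of_kernel_mem (S : Submodule ℂ FockSpace) (hS : ∀ w, kernel w ∈ S) :
    Dense (S : Set FockSpace) := by
  rw [Submodule.dense_iff_topologicalClosure_eq_top, Submodule.topologicalClosure_eq_top_iff,
    eq_bot_iff, ← span_kernel_orthogonal]
  exact Submodule.orthogonal_le (Submodule.span_le.mpr (Set.range_subset_iff.mpr hS))

end FockSpace

/-! ### Uniqueness for the functional equation -/

/-- An entire function satisfying `f z = -κ exp (c (z - p)) f (p + α (z - p))` with `κ > 0` and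
`α ≥ 0` vanishes: compare the terms of lowest order at `p`. -/
theorem eq_zero_of_dilation_eq {f : ℂ → ℂ} (hf : Differentiable ℂ f) {κ α : ℝ} (hκ : 0 < κ)
    (hα : 0 ≤ α) (c p : ℂ)
    (h : ∀ z, f z = -(κ * Complex.exp (c * (z - p)) * f (p + α * (z - p)))) : f = 0 := by
  by_contra hne
  have han : AnalyticAt ℂ f p := hf.analyticAt p
  have hev : ¬ ∀ᶠ z in nhds p, f z = 0 := fun h0 =>
    hne (AnalyticOnNhd.eq_of_eventuallyEq (fun z _ => hf.analyticAt z)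
      (fun z _ => analyticAt_const) h0)
  obtain ⟨n, g, hg, hg0, hfg⟩ := han.exists_eventuallyEq_pow_smul_nonzero_iff.mpr hev
  have hmap : Filter.Tendsto (fun z : ℂ => p + α * (z - p)) (nhds p) (nhds p) := by
    have : Continuous fun z : ℂ => p + α * (z - p) := by fun_prop
    simpa using this.tendsto p
  -- Cancelling `(z - p) ^ n` requires `z ≠ p`; letting `z → p` then gives `(1 + κ α ^ n) g(p) = 0`,
  -- whose first factor is positive.
  have h1 : ∀ᶠ z in nhdsWithin p {p}ᶜ,
      g z = -(κ * Complex.exp (c * (z - p)) * (α ^ n * g (p + α * (z - p)))) := by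
    filter_upwards [hfg.filter_mono nhdsWithin_le_nhds,
      (hmap.eventually hfg).filter_mono nhdsWithin_le_nhds, self_mem_nhdsWithin] with z h2 h3 hz
    have hz' : (z - p) ^ n ≠ 0 := pow_ne_zero _ (sub_ne_zero.mpr hz)
    apply mul_left_cancel₀ hz'
    have h4 := h z
    rw [h2, h3] at h4
    simp only [smul_eq_mul, add_sub_cancel_left, mul_pow] at h4
    rw [h4]
    ring
  have hlim : Filter.Tendsto
      (fun z => -(κ * Complex.exp (c * (z - p)) * (α ^ n * g (p + α * (z - p)))))
      (nhdsWithin p {p}ᶜ) (nhds (-(κ * Complex.exp (c * (p - p)) * (α ^ n * g p)))) := by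
    refine Filter.Tendsto.mono_left ?_ nhdsWithin_le_nhds
    have hexp : Continuous fun z : ℂ => (κ : ℂ) * Complex.exp (c * (z - p)) := by fun_prop
    exact ((hexp.tendsto p).mul ((hg.continuousAt.tendsto.comp hmap).const_mul _)).neg
  have heq := tendsto_nhds_unique (hg.continuousAt.tendsto.mono_left nhdsWithin_le_nhds)
    (hlim.congr' (h1.mono fun z hz => hz.symm))
  rw [sub_self, mul_zero, Complex.exp_zero, mul_one] at heq
  have h5 : ((1 + κ * α ^ n : ℝ) : ℂ) * g p = 0 := by
    push_cast
    linear_combination heq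
  rcases mul_eq_zero.mp h5 with h6 | h6
  · have : 0 < 1 + κ * α ^ n := by positivity
    exact this.ne' (Complex.ofReal_eq_zero.mp h6)
  · exact hg0 h6

/-- An entire function of Fock growth satisfying `f z = -k exp (conj m z) f (z + m)` with `k > 0`
vanishes: up to a Gaussian factor it is antiperiodic and bounded. -/
theorem eq_zero_of_translation_eq {f : ℂ → ℂ} (hf : Differentiable ℂ f) {M : ℝ}
    (hM : ∀ z, ‖f z‖ ≤ Real.exp (‖z‖ ^ 2 / 2) * M) {k : ℝ} (hk : 0 < k) {m : ℂ} (hm : m ≠ 0)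
    (h : ∀ z, f z = -(k * Complex.exp ((starRingEnd ℂ) m * z) * f (z + m))) : f = 0 := by
  -- `δ` solves `‖m‖² / 2 + δ = log k`, so that the exponent of `q` grows by `log k + ‖m‖² t` from
  -- `t` to `t + 1`, exactly absorbing the factor in `h`.
  set δ : ℝ := Real.log k - ‖m‖ ^ 2 / 2 with hδ
  let q : ℂ → ℂ := fun t => f (m * t) * Complex.exp (‖m‖ ^ 2 * t ^ 2 / 2 + δ * t)
  have hqd : Differentiable ℂ q := by fun_prop
  have hanti : Function.Antiperiodic q 1 := by
    intro t
    have hkexp : (k : ℂ) = Complex.exp (Real.log k : ℝ) := by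
      rw [← Complex.ofReal_exp, Real.exp_log hk]
    have hmm : (starRingEnd ℂ) m * (m * t) = ‖m‖ ^ 2 * t := by
      rw [← mul_assoc, Complex.conj_mul']
    simp only [q]
    rw [h (m * t), hmm, hkexp, ← Complex.exp_add, mul_add, mul_one]
    have h2 : Complex.exp (‖m‖ ^ 2 * (t + 1) ^ 2 / 2 + (δ * t + δ)) =
        Complex.exp ((Real.log k : ℝ) + ‖m‖ ^ 2 * t) *
          Complex.exp (‖m‖ ^ 2 * t ^ 2 / 2 + δ * t) := by
      rw [← Complex.exp_add]
      congr 1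
      rw [hδ]
      push_cast
      ring
    rw [mul_add, mul_one, h2]
    ring
  have hstrip (t : ℂ) (h0 : 0 ≤ t.re) (h1 : t.re ≤ 1) :
      ‖q t‖ ≤ Real.exp (‖m‖ ^ 2 + |δ|) * M := by
    have hM0 : 0 ≤ M := by
      have := (norm_nonneg _).trans (hM 0)
      simpa using this
    simp only [q, norm_mul, Complex.norm_exp]
    -- The growth bound contributes `‖m‖² (t.im)² / 2` to the exponent and the Gaussian factor its
    -- negative, so the bound depends on `t.re` alone.
    calc _ ≤ Real.exp (‖m * t‖ ^ 2 / 2) * M *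
          Real.exp (‖m‖ ^ 2 * t ^ 2 / 2 + δ * t : ℂ).re := by gcongr; exact hM _
      _ = Real.exp (‖m‖ ^ 2 * t.re ^ 2 + δ * t.re) * M := by
        rw [mul_right_comm, ← Real.exp_add]
        congr 2
        have h3 : (‖m‖ ^ 2 * t ^ 2 / 2 + δ * t : ℂ).re =
            ‖m‖ ^ 2 * (t.re ^ 2 - t.im ^ 2) / 2 + δ * t.re := by
          have : (‖m‖ ^ 2 * t ^ 2 / 2 + δ * t : ℂ) =
              ((‖m‖ ^ 2 / 2 : ℝ) : ℂ) * (t * t) + (δ : ℂ) * t := by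
            push_cast
            ring
          rw [this, Complex.add_re, Complex.re_ofReal_mul, Complex.re_ofReal_mul, Complex.mul_re]
          ring
        rw [h3, norm_mul, mul_pow, ← Complex.normSq_eq_norm_sq t, Complex.normSq_apply]
        ring
      _ ≤ _ := by
        gcongr
        · exact mul_le_of_le_one_right (by positivity) (pow_le_one₀ h0 h1)
        · calc δ * t.re ≤ |δ| * t.re := by gcongr; exact le_abs_self δ
            _ ≤ |δ| := mul_le_of_le_one_right (abs_nonneg _) h1
  have hper : Function.Periodic (fun t => ‖q t‖) 1 := fun t => by
    simp only [hanti t, norm_neg]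
  have hbdd (t : ℂ) : ‖q t‖ ≤ Real.exp (‖m‖ ^ 2 + |δ|) * M := by
    have h2 := hper.sub_int_mul_eq ⌊t.re⌋ (x := t)
    simp only [mul_one] at h2
    rw [← h2]
    refine hstrip _ ?_ ?_
    · simp
    · simpa using (Int.fract_lt_one t.re).le
  -- By Liouville `q` is constant, and an antiperiodic constant is zero.
  have hq0 (t : ℂ) : q t = 0 := by
    have h2 : q (t + 1) = q t := hqd.apply_eq_apply_of_bounded
      (isBounded_iff_forall_norm_le.mpr ⟨_, Set.forall_mem_range.mpr hbdd⟩) _ _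
    rw [hanti t] at h2
    exact neg_eq_self.mp h2
  funext z
  have h2 := hq0 (z / m)
  simp only [q, mul_div_cancel₀ z hm] at h2
  exact (mul_eq_zero.mp h2).resolve_right (Complex.exp_ne_zero _)

/-- An entire function of Fock growth satisfying `f z = -k exp (conj m z) f (α z + m)` with `k > 0`
and `α ≥ 0` vanishes. -/
theorem eq_zero_of_affine_eq {f : ℂ → ℂ} (hf : Differentiable ℂ f) {M : ℝ}
    (hM : ∀ z, ‖f z‖ ≤ Real.exp (‖z‖ ^ 2 / 2) * M) {k α : ℝ} (hk : 0 < k) (hα : 0 ≤ α) (m : ℂ)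
    (h : ∀ z, f z = -(k * Complex.exp ((starRingEnd ℂ) m * z) * f (α * z + m))) : f = 0 := by
  by_cases hcase : α = 1 ∧ m ≠ 0
  · obtain ⟨rfl, hm⟩ := hcase
    exact eq_zero_of_translation_eq hf hM hk hm (by simpa using h)
  -- `s * m` is a fixed point of `z ↦ α z + m`.
  obtain ⟨s, hs⟩ : ∃ s : ℝ, α * (s * m) + m = s * m := by
    by_cases hα1 : α = 1
    · have hm : m = 0 := by tauto
      exact ⟨0, by simp [hm]⟩
    · refine ⟨(1 - α)⁻¹, ?_⟩
      have h1 : (1 - α : ℂ) ≠ 0 := by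
        rw [sub_ne_zero]
        exact_mod_cast Ne.symm hα1
      push_cast
      field_simp
      ring
  -- Recentring `exp(conj m z)` at the fixed point `s m` produces the extra positive factor `exp(s
  -- ‖m‖²)`.
  refine eq_zero_of_dilation_eq hf (κ := k * Real.exp (s * ‖m‖ ^ 2)) (by positivity) hα
    ((starRingEnd ℂ) m) (s * m) fun z => ?_
  have h1 : (s * m : ℂ) + α * (z - s * m) = α * z + m := by linear_combination -hs
  rw [h1, Complex.ofReal_mul, Complex.ofReal_exp, mul_assoc (k : ℂ), ← Complex.exp_add, h z]
  congr 4
  push_cast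
  rw [← Complex.conj_mul']
  ring

/-! ### Action on kernels and the adjoint -/

namespace FockSpace

/-- A weighted composition operator with affine inner symbol and exponential weight maps kernels
to multiples of kernels. -/
theorem weight_mul_kernel_comp (A B C D w z : ℂ) :
    C * Complex.exp (D * z) * kernel w (A * z + B) =
      C * Complex.exp (B * (starRingEnd ℂ) w) *
        kernel ((starRingEnd ℂ) A * w + (starRingEnd ℂ) D) z := by
  simp only [kernel_apply, mul_assoc, ← Complex.exp_add, map_add, map_mul, Complex.conj_conj]
  congr 2
  ring

theorem kernel_mem_domain (A B C D w : ℂ) :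
    kernel w ∈ (weightedCompositionMax (fun z => C * Complex.exp (D * z))
      (fun z => A * z + B)).domain := by
  rw [mem_weightedCompositionMax_domain]
  simp only [weight_mul_kernel_comp]
  exact (((C * Complex.exp (B * (starRingEnd ℂ) w)) •
    kernel ((starRingEnd ℂ) A * w + (starRingEnd ℂ) D) : FockSpace)).mem

theorem weightedCompositionMax_kernel (A B C D w : ℂ) :
    weightedCompositionMax (fun z => C * Complex.exp (D * z)) (fun z => A * z + B)
        ⟨kernel w, kernel_mem_domain A B C D w⟩ =
      (C * Complex.exp (B * (starRingEnd ℂ) w)) •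
        kernel ((starRingEnd ℂ) A * w + (starRingEnd ℂ) D) :=
  ext fun z => weight_mul_kernel_comp A B C D w z

theorem inner_weightedCompositionMax_kernel (A B C D w : ℂ) (g : FockSpace) :
    inner ℂ (weightedCompositionMax (fun z => C * Complex.exp (D * z)) (fun z => A * z + B)
        ⟨kernel w, kernel_mem_domain A B C D w⟩) g =
      (starRingEnd ℂ) C * Complex.exp ((starRingEnd ℂ) B * w) *
        g ((starRingEnd ℂ) A * w + (starRingEnd ℂ) D) := by
  rw [weightedCompositionMax_kernel, inner_smul_left, inner_kernel, map_mul, ← Complex.exp_conj,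
    map_mul, Complex.conj_conj]

theorem dense_weightedCompositionMax_domain (A B C D : ℂ) :
    Dense ((weightedCompositionMax (fun z => C * Complex.exp (D * z))
      (fun z => A * z + B)).domain : Set FockSpace) :=
  dense_of_kernel_mem _ (kernel_mem_domain A B C D)

/-- The value at `w` is the inner product with `kernel w`, and the adjoint relation moves the
operator onto that kernel. -/
theorem adjoint_weightedCompositionMax_apply (A B C D : ℂ)
    (g : (weightedCompositionMax (fun z => C * Complex.exp (D * z))
      (fun z => A * z + B)).adjoint.domain) (w : ℂ) :
    (weightedCompositionMax (fun z => C * Complex.exp (D * z)) (fun z => A * z + B)).adjoint g w =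
      (starRingEnd ℂ) C * Complex.exp ((starRingEnd ℂ) B * w) *
        (g : FockSpace) ((starRingEnd ℂ) A * w + (starRingEnd ℂ) D) := by
  rw [← inner_kernel, ← inner_weightedCompositionMax_kernel]
  exact ((LinearPMap.adjoint_isFormalAdjoint
    (dense_weightedCompositionMax_domain A B C D)).symm ⟨kernel w, _⟩ g).symm

theorem adjoint_weightedCompositionMax_le (A B C D : ℂ) :
    (weightedCompositionMax (fun z => C * Complex.exp (D * z)) (fun z => A * z + B)).adjoint ≤
      weightedCompositionMax
        (fun z => (starRingEnd ℂ) C * Complex.exp ((starRingEnd ℂ) B * z))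
        (fun z => (starRingEnd ℂ) A * z + (starRingEnd ℂ) D) := by
  refine ⟨fun g hg => ?_, fun g g' hgg' => ?_⟩
  · rw [mem_weightedCompositionMax_domain,
      ← funext (adjoint_weightedCompositionMax_apply A B C D ⟨g, hg⟩)]
    exact FockSpace.mem _
  · ext w
    rw [adjoint_weightedCompositionMax_apply, weightedCompositionMax_apply, hgg']

/-- The graph of the maximal operator contains no nonzero vector orthogonal to the part of the graph
over the kernel functions. -/
theorem eq_zero_of_orthogonal_kernel_graph {A B C D : ℂ} (hC : C ≠ 0)
    (f : (weightedCompositionMax (fun z => C * Complex.exp (D * z)) (fun z => A * z + B)).domain)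
    (h : ∀ w, inner ℂ (kernel w) (f : FockSpace) +
      inner ℂ (weightedCompositionMax (fun z => C * Complex.exp (D * z)) (fun z => A * z + B)
        ⟨kernel w, kernel_mem_domain A B C D w⟩)
        (weightedCompositionMax (fun z => C * Complex.exp (D * z)) (fun z => A * z + B) f) = 0) :
    f = 0 := by
  refine Subtype.ext (DFunLike.coe_injective (F := FockSpace) ?_)
  refine eq_zero_of_affine_eq (f : FockSpace).differentiable (norm_apply_le_exp (f : FockSpace))
    (k := ‖C‖ ^ 2 * Real.exp (‖D‖ ^ 2)) (α := ‖A‖ ^ 2) (by positivity) (by positivity)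
    (A * (starRingEnd ℂ) D + B) fun z => ?_
  have h1 := h z
  rw [inner_kernel, inner_weightedCompositionMax_kernel, weightedCompositionMax_apply] at h1
  have h2 : A * ((starRingEnd ℂ) A * z + (starRingEnd ℂ) D) + B =
      ((‖A‖ ^ 2 : ℝ) : ℂ) * z + (A * (starRingEnd ℂ) D + B) := by
    push_cast
    rw [← Complex.mul_conj']
    ring
  -- The weights multiply to `|C|² exp(D conj D) exp((conj B + D conj A) z)`; positivity of the
  -- constant is where `C ≠ 0` enters.
  have h3 : (starRingEnd ℂ) C * Complex.exp ((starRingEnd ℂ) B * z) *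
      (C * Complex.exp (D * ((starRingEnd ℂ) A * z + (starRingEnd ℂ) D))) =
      ((‖C‖ ^ 2 * Real.exp (‖D‖ ^ 2) : ℝ) : ℂ) *
        Complex.exp ((starRingEnd ℂ) (A * (starRingEnd ℂ) D + B) * z) := by
    push_cast
    rw [← Complex.mul_conj', ← Complex.mul_conj', mul_assoc (C * _), ← Complex.exp_add,
      mul_mul_mul_comm, ← Complex.exp_add, mul_comm C]
    congr 2
    simp only [map_add, map_mul, Complex.conj_conj]
    ring
  rw [h2, ← mul_assoc, h3] at h1
  exact eq_neg_of_add_eq_zero_left h1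

/-- The identity is immediate when `f` is a kernel. It passes to every `f` in the domain because the
graph of `W` lies in the closed span `Gᗮᗮ` of its part over the kernels. -/
theorem isFormalAdjoint_weightedCompositionMax {A B C D : ℂ} (hC : C ≠ 0) :
    (weightedCompositionMax (fun z => C * Complex.exp (D * z)) (fun z => A * z + B)).IsFormalAdjoint
      (weightedCompositionMax
        (fun z => (starRingEnd ℂ) C * Complex.exp ((starRingEnd ℂ) B * z))
        (fun z => (starRingEnd ℂ) A * z + (starRingEnd ℂ) D)) := by
  set W := weightedCompositionMax (fun z => C * Complex.exp (D * z)) (fun z => A * z + B)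
  set V := weightedCompositionMax
        (fun z => (starRingEnd ℂ) C * Complex.exp ((starRingEnd ℂ) B * z))
        (fun z => (starRingEnd ℂ) A * z + (starRingEnd ℂ) D)
  intro f g
  have hW (f : W.domain) (z : ℂ) :
      W f z = C * Complex.exp (D * z) * (f : FockSpace) (A * z + B) :=
    weightedCompositionMax_apply f z
  let k : ℂ → WithLp 2 (FockSpace × FockSpace) := fun w =>
    WithLp.toLp 2 (kernel w, W ⟨kernel w, kernel_mem_domain A B C D w⟩)
  let G : Submodule ℂ (WithLp 2 (FockSpace × FockSpace)) := Submodule.span ℂ (Set.range k)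
  have hk {x : WithLp 2 (FockSpace × FockSpace)} : x ∈ Gᗮ ↔ ∀ w, inner ℂ (k w) x = 0 := by
    refine ⟨fun hx w => hx _ (Submodule.subset_span ⟨w, rfl⟩), fun hx => ?_⟩
    have : G ≤ (ℂ ∙ x)ᗮ := Submodule.span_le.mpr (Set.range_subset_iff.mpr fun w =>
      Submodule.mem_orthogonal_singleton_iff_inner_left.mpr (hx w))
    exact fun u hu => Submodule.mem_orthogonal_singleton_iff_inner_left.mp (this hu)
  -- the closure of the span of the kernel part of the graph lies in the graph
  have hgraph {x : WithLp 2 (FockSpace × FockSpace)} (hx : x ∈ Gᗮᗮ) (w : ℂ) :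
      x.snd w = C * Complex.exp (D * w) * x.fst (A * w + B) := by
    -- Orthogonality to this vector encodes the graph equation at the point `w`: its two components
    -- evaluate `x.fst` at `A * w + B`, with the weight, and `x.snd` at `w`.
    let y : WithLp 2 (FockSpace × FockSpace) := WithLp.toLp 2
      ((starRingEnd ℂ) (C * Complex.exp (D * w)) • kernel (A * w + B), -kernel w)
    have hy : y ∈ Gᗮ := by
      refine hk.mpr fun v => ?_
      rw [WithLp.prod_inner_apply]
      change inner ℂ (kernel v) ((starRingEnd ℂ) (C * Complex.exp (D * w)) • kernel (A * w + B)) +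
        inner ℂ (W ⟨kernel v, kernel_mem_domain A B C D v⟩) (-kernel w) = 0
      rw [inner_smul_right, inner_neg_right, inner_kernel_right, inner_kernel_right,
        hW, ← map_mul]
      exact add_neg_cancel _
    have h1 := hx y hy
    rw [WithLp.prod_inner_apply] at h1
    change inner ℂ ((starRingEnd ℂ) (C * Complex.exp (D * w)) • kernel (A * w + B)) x.fst +
      inner ℂ (-kernel w) x.snd = 0 at h1
    rw [inner_smul_left, inner_neg_left, inner_kernel, inner_kernel, Complex.conj_conj] at h1
    linear_combination -h1
  -- the graph lies in the closure of the span of its kernel part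
  have hf : (WithLp.toLp 2 ((f : FockSpace), W f) : WithLp 2 (FockSpace × FockSpace)) ∈ Gᗮᗮ := by
    set x : WithLp 2 (FockSpace × FockSpace) := WithLp.toLp 2 ((f : FockSpace), W f)
    -- Both `x` and `v` satisfy the graph equation, hence so does `u = x - v`; being also in `Gᗮ`,
    -- it vanishes by `eq_zero_of_orthogonal_kernel_graph`.
    obtain ⟨u, hu, v, hv, huv⟩ := Submodule.exists_add_mem_mem_orthogonal (K := Gᗮ) x
    have hu2 (w : ℂ) : u.snd w = C * Complex.exp (D * w) * u.fst (A * w + B) := by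
      have h1 := hgraph hv w
      have h2 : W f w = u.snd w + v.snd w := congrArg (fun y => (WithLp.snd y) w) huv
      have h3 : (f : FockSpace) (A * w + B) = u.fst (A * w + B) + v.fst (A * w + B) :=
        congrArg (fun y => (WithLp.fst y) (A * w + B)) huv
      rw [hW, h3, h1] at h2
      linear_combination -h2
    have hmem : u.fst ∈ W.domain := by
      change (fun w => C * Complex.exp (D * w) * u.fst (A * w + B)) ∈ fockSubmodule
      rw [← funext hu2]
      exact u.snd.mem
    have hWu : W ⟨u.fst, hmem⟩ = u.snd := ext fun w => (hu2 w).symm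
    have hzero : (⟨u.fst, hmem⟩ : W.domain) = 0 := by
      refine eq_zero_of_orthogonal_kernel_graph hC _ fun w => ?_
      have h1 := hk.mp hu w
      rw [WithLp.prod_inner_apply] at h1
      change inner ℂ (kernel w) u.fst +
        inner ℂ (W ⟨kernel w, kernel_mem_domain A B C D w⟩) u.snd = 0 at h1
      rw [← hWu] at h1
      exact h1
    have hu0 : u = 0 := by
      have h1 : u.fst = 0 := congrArg Subtype.val hzero
      have h2 : u.snd = 0 := by rw [← hWu, hzero, LinearPMap.map_zero]
      exact (WithLp.ofLp_injective 2) (Prod.ext h1 h2)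
    rw [huv, hu0, zero_add]
    exact hv
  -- Membership of `(-V g, g)` in `Gᗮ` is the adjoint identity on kernels; its orthogonality to `(f,
  -- W f)` is the identity for `f`.
  let y : WithLp 2 (FockSpace × FockSpace) := WithLp.toLp 2 (-V g, (g : FockSpace))
  have hy : y ∈ Gᗮ := by
    refine hk.mpr fun w => ?_
    rw [WithLp.prod_inner_apply]
    change inner ℂ (kernel w) (-V g) +
      inner ℂ (W ⟨kernel w, kernel_mem_domain A B C D w⟩) (g : FockSpace) = 0
    rw [inner_neg_right, inner_kernel]
    refine (congrArg _ (inner_weightedCompositionMax_kernel A B C D w g)).trans ?_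
    exact neg_add_cancel _
  have h1 := Submodule.inner_left_of_mem_orthogonal hy hf
  rw [WithLp.prod_inner_apply] at h1
  change inner ℂ (f : FockSpace) (-V g) + inner ℂ (W f) (g : FockSpace) = 0 at h1
  rw [inner_neg_right] at h1
  linear_combination h1

end FockSpace

theorem theorem3p7 (A B C D : ℂ) (hC : C ≠ 0) :
    Dense ((weightedCompositionMax (fun z => C * Complex.exp (D * z))
      (fun z => A * z + B)).domain : Set FockSpace) ∧
    (weightedCompositionMax (fun z => C * Complex.exp (D * z)) (fun z => A * z + B)).adjoint =
      weightedCompositionMax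
        (fun z => (starRingEnd ℂ) C * Complex.exp ((starRingEnd ℂ) B * z))
        (fun z => (starRingEnd ℂ) A * z + (starRingEnd ℂ) D) :=
  have hdense := FockSpace.dense_weightedCompositionMax_domain A B C D
  ⟨hdense, le_antisymm (FockSpace.adjoint_weightedCompositionMax_le A B C D)
    ((FockSpace.isFormalAdjoint_weightedCompositionMax hC).le_adjoint hdense)⟩
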